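/- Let $Q\subset\mathbb{R}^2$ be a (closed, filled) convex $n$-gon, $n\ge 3$, containing the origin, and let $d$ be its diameter. The outer length billiard map $T$ about $Q$ is defined as follows. For $x\notin Q$ let $\ell_1,\ell_2$ be the two support lines of $Q$ through $x$, labelled so that travelling to $x$ from $Q$ along $\ell_1$, and travelling from $x$ to $Q$ along $\ell_2$, keeps $Q$ on the left. If $\ell_2\cap Q$ is a single point $r$, let $C$ be the circle which is tangent to $\ell_1$ and $\ell_2$, touches $\ell_2$ at $r$, and lies on the side of $\ell_2$ opposite to $Q$; let $\ell_3$ be the third common support line of $Q$ and $C$, and put $T(x)=\ell_2\cap\ell_3$. If $\ell_2\cap Q$ is not a single point, $T(x)$ is undefined. The domain $\Omega$ of $T$ is the set of points $x\notin Q$ for which all iterates $T^k(x)$, $k\ge 0$, are defined. For $x\in\Omega$ use polar coordinates in which $x$ lies on the radial $\theta=0$, with $\theta\in[-\pi,\pi)$, and let $N$ be the smallest positive integer such that $T^{2(N-1)}(x)$ has positive argument while $T^{2N}(x)$ has non-positive argument. The once-around orbit of $x$ is $\mathcal{O}(x)=\{x,T(x),\dots,T^{2N}(x)\}$, or the whole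 forward orbit $\{T^k(x):k\ge0\}$ if there is no such $N$. Then there are constants $C_1\le(4\pi+3)d$ and $C_2=(4\pi+11)d$ such that for every $x\in\Omega$ with $R:=|x|\ge C_2$, every point of $\mathcal{O}(x)$ lies in the annulus $|r-R|\le C_1$, i.e. $\bigl||z|-R\bigr|\le C_1$ for all $z\in\mathcal{O}(x)$. -/

import Mathlib

namespace OuterLength

open Complex Metric

/-- The signed area `a₁ b₂ - a₂ b₁` of two plane vectors. The Euclidean plane is `ℂ` throughout. -/
def cross (a b : ℂ) : ℝ := a.re * b.im - a.im * b.re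

/-- Travelling along the line from `a` towards `b` keeps the set `S` on the left
(points of `S` on the line itself are allowed). -/
def KeepsOnLeft (a b : ℂ) (S : Set ℂ) : Prop := ∀ z ∈ S, 0 ≤ cross (b - a) (z - a)

/-- `ℓ` is a support line of `S`: it is a line which meets `S` and has `S` on one side
(on the left, for one of the two directions of travel). -/
def IsSupportLine (ℓ : AffineSubspace ℝ ℂ) (S : Set ℂ) : Prop :=
  (∃ a b : ℂ, a ≠ b ∧ ℓ = line[ℝ, a, b] ∧ KeepsOnLeft a b S) ∧ ∃ z ∈ S, z ∈ ℓ

/-- `Q` is a (closed, filled) convex `n`-gon: the convex hull of `n ≥ 3` points, its vertices,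
none of which lies in the convex hull of the others. -/
def IsConvexNGon (n : ℕ) (Q : Set ℂ) : Prop :=
  3 ≤ n ∧ ∃ V : Finset ℂ, V.card = n ∧ ConvexIndependent ℝ (fun v : V => (v : ℂ)) ∧
    Q = convexHull ℝ (V : Set ℂ)

/-- The construction of the outer length billiard about `K`, applied to `x`, yields `y`.
Here `ℓ₁ = line[ℝ, x, l]` and `ℓ₂ = line[ℝ, x, r]` are the two support lines of `K` through `x`,
`r` is the only point of `ℓ₂ ∩ K`, the auxiliary circle has centre `c` and radius `ρ`, and
`ℓ₃` is the third common support line of `K` and the circle. -/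
def IsImage (K : Set ℂ) (x y : ℂ) : Prop :=
  x ∉ K ∧ ∃ (l r c : ℂ) (ρ : ℝ) (ℓ₃ : AffineSubspace ℝ ℂ),
    -- travelling to `x` from `K` along `ℓ₁` keeps `K` on the left
    (l ∈ K ∧ KeepsOnLeft l x K) ∧
    -- travelling from `x` towards `K` along `ℓ₂` keeps `K` on the left; the contact point is unique
    (r ∈ K ∧ KeepsOnLeft x r K ∧ (line[ℝ, x, r] : Set ℂ) ∩ K = {r}) ∧
    -- the circle touches `ℓ₂` at `r`, from the side of `ℓ₂` opposite to `K`, and it touches `ℓ₁`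
    (0 < ρ ∧ r ∈ closedBall c ρ ∧ KeepsOnLeft r x (closedBall c ρ) ∧
      IsSupportLine line[ℝ, x, l] (closedBall c ρ)) ∧
    -- the third common support line meets `ℓ₂` at `y`
    (IsSupportLine ℓ₃ K ∧ IsSupportLine ℓ₃ (closedBall c ρ) ∧
      ℓ₃ ≠ line[ℝ, x, l] ∧ ℓ₃ ≠ line[ℝ, x, r] ∧ y ∈ line[ℝ, x, r] ∧ y ∈ ℓ₃)

open Classical in
/-- The outer length billiard map about `K`
(with the irrelevant value `x` at points `x` where the construction cannot be carried out). -/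
noncomputable def billiardMap (K : Set ℂ) (x : ℂ) : ℂ :=
  if h : ∃ y, IsImage K x y then h.choose else x

/-- The set of non-singular points: those at which the construction can be carried out,
now and at all forward iterates. -/
def domain (K : Set ℂ) : Set ℂ :=
  {x | ∀ k : ℕ, ∃ y, IsImage K ((billiardMap K)^[k] x) y}

/-- The argument in `[-π, π)` of `z`, in polar coordinates about the origin in which `x` lies
on the radial `θ = 0`. -/
noncomputable def polarArg (x z : ℂ) : ℝ :=
  if arg (z / x) = Real.pi then -Real.pi else arg (z / x)

/-- The orbit of the square of the map, started at `x`, wraps around at time `N`. -/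
def WrapsAt (K : Set ℂ) (x : ℂ) (N : ℕ) : Prop :=
  0 < N ∧ 0 < polarArg x ((billiardMap K)^[2 * (N - 1)] x) ∧
    polarArg x ((billiardMap K)^[2 * N] x) ≤ 0

/-- The once-around orbit `{x, T x, …, T^(2N) x}`, with `N` the first time of wrapping around;
the whole forward orbit if there is no such time. -/
def onceAroundOrbit (K : Set ℂ) (x : ℂ) : Set ℂ :=
  {z | ∃ k : ℕ, z = (billiardMap K)^[k] x ∧ ∀ N, IsLeast {N | WrapsAt K x N} N → k ≤ 2 * N}

end OuterLength

namespace OuterLength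

open Complex Metric

/-! The nearly conserved quantity is the sum `a + b` of the two tangent lengths from the moving
point to `Q`. Since `0 ∈ Q`, each tangent length differs from the norm of the point by at most `d`,
so it suffices to control this sum.

Far from `Q`, the lines `ℓ₁`, `ℓ₂`, `ℓ₃` of one step bound a triangle around `Q`, and the auxiliary
circle is its excircle opposite the apex `ℓ₁ ∩ ℓ₃`. Equality of the two tangents from the apex gives
`(a + b) - (a' + b') = t - s`, where `s`, `t` are the distances from the apex to the contact points
`l`, `q` (`Step.exists_decomp`). The apex angle is close to `π`, so `s + t` is nearly the component
of `l - q = s u + t w` along `(u + w) / 2`. Up to `d` times the turning of the support line, this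
component is `dot l u - dot q w`, which telescopes along the orbit (`Step.abs_sub_le_turn`,
`IsOrbit.abs_tangents_sub_le`). The total drift is thus bounded by `d` times a constant plus the
total turning. A bootstrap keeps the orbit at distance at least `8 d` as long as the turning is at
most `3π` (`IsOrbit.annulus`).

The second iterate moves clockwise, with direction turned by `turn`; hence the argument changes from
positive to negative before the turning reaches `3π`, which bounds the turning on a once-around
orbit (`turn_le_of_mem_onceAroundOrbit`). -/

/-- The Euclidean inner product of two plane vectors. -/
def dot (a b : ℂ) : ℝ := a.re * b.re + a.im * b.im

/-! ### Vector algebra, lines and support lines. -/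

lemma cross_smul_left (t : ℝ) (a b : ℂ) : cross (t * a) b = t * cross a b := by
  simp [cross]; ring

lemma sq_add_sq_of_norm_eq_one {u : ℂ} (hu : ‖u‖ = 1) : u.re ^ 2 + u.im ^ 2 = 1 := by
  have h := Complex.sq_norm u
  rw [hu, Complex.normSq_apply] at h
  linarith

lemma dot_sq_add_cross_sq {u v : ℂ} (hu : ‖u‖ = 1) (hv : ‖v‖ = 1) :
    dot u v ^ 2 + cross u v ^ 2 = 1 := by
  have h1 := sq_add_sq_of_norm_eq_one hu
  have h2 := sq_add_sq_of_norm_eq_one hv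
  simp only [dot, cross]
  linear_combination (v.re ^ 2 + v.im ^ 2) * h1 + h2

lemma sq_dot_add_sq_cross (u v : ℂ) : dot u v ^ 2 + cross u v ^ 2 = ‖u‖ ^ 2 * ‖v‖ ^ 2 := by
  rw [Complex.sq_norm, Complex.sq_norm, Complex.normSq_apply, Complex.normSq_apply]
  simp only [dot, cross]
  ring

lemma abs_dot_le (u v : ℂ) : |dot u v| ≤ ‖u‖ * ‖v‖ := by
  apply abs_le_of_sq_le_sq _ (by positivity)
  rw [mul_pow, ← sq_dot_add_sq_cross]
  nlinarith [sq_nonneg (cross u v)]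

lemma abs_cross_le (u v : ℂ) : |cross u v| ≤ ‖u‖ * ‖v‖ := by
  apply abs_le_of_sq_le_sq _ (by positivity)
  rw [mul_pow, ← sq_dot_add_sq_cross]
  nlinarith [sq_nonneg (dot u v)]

lemma exists_eq_add_mul_unit {a b : ℂ} (h : a ≠ b) :
    ∃ t : ℝ, 0 < t ∧ ∃ u : ℂ, ‖u‖ = 1 ∧ b = a + t * u := by
  have h' : 0 < ‖b - a‖ := norm_pos_iff.2 (sub_ne_zero.2 h.symm)
  have h'' : (‖b - a‖ : ℂ) ≠ 0 := by exact_mod_cast h'.ne'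
  refine ⟨‖b - a‖, h', (b - a) / ‖b - a‖, ?_, ?_⟩
  · rw [norm_div, Complex.norm_real, norm_norm, div_self h'.ne']
  · field_simp
    ring

lemma pos_mul_unit_injective {s t : ℝ} {u v : ℂ} (hs : 0 < s) (ht : 0 < t) (hu : ‖u‖ = 1)
    (hv : ‖v‖ = 1) (h : (s : ℂ) * u = t * v) : s = t ∧ u = v := by
  have h1 := congrArg norm h
  rw [norm_mul, norm_mul, hu, hv, Complex.norm_real, Complex.norm_real, Real.norm_of_nonneg hs.le,
    Real.norm_of_nonneg ht.le, mul_one, mul_one] at h1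
  subst h1
  exact ⟨rfl, mul_left_cancel₀ (by exact_mod_cast hs.ne') h⟩

lemma eq_mul_of_cross_eq_zero {w z : ℂ} (hw : ‖w‖ = 1) (h : cross w z = 0) :
    z = (dot w z : ℝ) * w := by
  have h1 := sq_add_sq_of_norm_eq_one hw
  simp only [cross] at h
  apply Complex.ext
  · simp [dot]
    linear_combination (-z.re) * h1 - w.im * h
  · simp [dot]
    linear_combination (-z.im) * h1 + w.re * h

lemma eq_or_eq_neg_of_cross_eq_zero {u v : ℂ} (hu : ‖u‖ = 1) (hv : ‖v‖ = 1)
    (h : cross u v = 0) : v = u ∨ v = -u := by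
  have h1 := dot_sq_add_cross_sq hu hv
  rw [h] at h1
  have h2 := eq_mul_of_cross_eq_zero hu h
  have h3 : (dot u v - 1) * (dot u v + 1) = 0 := by linear_combination h1
  rcases mul_eq_zero.1 h3 with h4 | h4
  · left
    rw [h2, show dot u v = 1 by linarith]; simp
  · right
    rw [h2, show dot u v = -1 by linarith]; simp

lemma mem_line_iff {a b : ℂ} (h : a ≠ b) (z : ℂ) :
    z ∈ line[ℝ, a, b] ↔ cross (b - a) (z - a) = 0 := by
  obtain ⟨t, ht, u, hu, rfl⟩ := exists_eq_add_mul_unit h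
  constructor
  · intro hz
    obtain ⟨s, rfl⟩ := mem_affineSpan_pair_iff_exists_lineMap_eq.1 hz
    simp [cross, AffineMap.lineMap_apply]
    ring
  · intro hz
    rw [add_sub_cancel_left, cross_smul_left] at hz
    have hz' := eq_mul_of_cross_eq_zero hu ((mul_eq_zero.1 hz).resolve_left ht.ne')
    refine mem_affineSpan_pair_iff_exists_lineMap_eq.2 ⟨dot u (z - a) / t, ?_⟩
    have : (t : ℂ) ≠ 0 := by exact_mod_cast ht.ne'
    simp only [AffineMap.lineMap_apply, vsub_eq_sub, vadd_eq_add, add_sub_cancel_left,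
      Complex.real_smul]
    push_cast
    rw [div_mul_eq_mul_div, mul_div_assoc, mul_div_cancel_left₀ _ this]
    linear_combination -hz'

lemma mem_line_add_mul_iff {t : ℝ} (ht : t ≠ 0) {u : ℂ} (hu : ‖u‖ = 1) (a z : ℂ) :
    z ∈ line[ℝ, a, a + t * u] ↔ cross u (z - a) = 0 := by
  have ht' : (t : ℂ) ≠ 0 := by exact_mod_cast ht
  have hu' : u ≠ 0 := by rintro rfl; simp at hu
  rw [mem_line_iff (by simp [ht', hu']), add_sub_cancel_left, cross_smul_left]
  simp [ht]

lemma IsSupportLine.exists_unit {ℓ : AffineSubspace ℝ ℂ} {S : Set ℂ} (h : IsSupportLine ℓ S) :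
    ∃ a w : ℂ, ‖w‖ = 1 ∧ (∀ z, z ∈ ℓ ↔ cross w (z - a) = 0) ∧ (∀ z ∈ S, 0 ≤ cross w (z - a)) ∧
      ∃ z ∈ S, cross w (z - a) = 0 := by
  obtain ⟨⟨a, b, hab, rfl, hS⟩, z, hz, hzl⟩ := h
  obtain ⟨t, ht, u, hu, rfl⟩ := exists_eq_add_mul_unit hab
  refine ⟨a, u, hu, mem_line_add_mul_iff ht.ne' hu a, fun z hz => ?_, z, hz,
    (mem_line_add_mul_iff ht.ne' hu a z).1 hzl⟩
  have := hS z hz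
  rw [add_sub_cancel_left, cross_smul_left] at this
  exact nonneg_of_mul_nonneg_right this ht

lemma cross_center_eq_radius {c a w : ℂ} {ρ : ℝ} (hρ : 0 < ρ) (hw : ‖w‖ = 1)
    (h : ∀ z ∈ closedBall c ρ, 0 ≤ cross w (z - a))
    (h' : ∃ z ∈ closedBall c ρ, cross w (z - a) = 0) : cross w (c - a) = ρ := by
  have h1 := sq_add_sq_of_norm_eq_one hw
  apply le_antisymm
  · obtain ⟨z, hz, hz0⟩ := h'
    have h2 := abs_cross_le w (z - c)
    rw [hw, one_mul] at h2
    rw [mem_closedBall, dist_eq_norm] at hz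
    have h3 := (abs_le.1 h2).1
    have h4 : cross w (z - a) = cross w (c - a) + cross w (z - c) := by simp [cross]; ring
    linarith
  -- The point of the disc farthest to the right of the direction `w`.
  · have h2 := h (c - ρ * I * w) (by simp [hw, abs_of_pos hρ])
    have h3 : cross w (c - ρ * I * w - a) = cross w (c - a) - ρ := by
      simp [cross]
      linear_combination -ρ * h1
    linarith

lemma eq_or_eq_neg_of_same_line {a a' w w' : ℂ} (hw : ‖w‖ = 1) (hw' : ‖w'‖ = 1)
    (h : ∀ z, cross w (z - a) = 0 ↔ cross w' (z - a') = 0) : w' = w ∨ w' = -w := by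
  apply eq_or_eq_neg_of_cross_eq_zero hw hw'
  have h1 := (h a).1 (by simp [cross])
  have h2 := (h (a + w)).1 (by simp [cross]; ring)
  simp [cross] at h1 h2 ⊢
  linarith

/-! ### The billiard triangle in vector form. -/

/-- Comparing two lines through different points of an axis: the identity
`sin (θ - θ') (1 + m²) (1 + m'²) = 2 (m' - m) (1 + m m')`, with `m`, `m'` the cotangents of the
half angles. -/
lemma sin_sub_mul_eq {s k s' k' m m' : ℝ} (h : s ^ 2 + k ^ 2 = 1) (h' : s' ^ 2 + k' ^ 2 = 1)
    (hs : 0 < s) (hs' : 0 < s') (hm : m * s = 1 + k) (hm' : m' * s' = 1 + k') :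
    (s * k' - k * s') * ((1 + m ^ 2) * (1 + m' ^ 2)) = 2 * (m' - m) * (1 + m * m') := by
  have e1 : ∀ {s k m : ℝ}, s ^ 2 + k ^ 2 = 1 → 0 < s → m * s = 1 + k →
      s * (1 + m ^ 2) = 2 * m ∧ k * (1 + m ^ 2) = m ^ 2 - 1 := by
    intro s k m h hs hm
    have hk : k = m * s - 1 := by linarith
    subst hk
    have : s * (s * (1 + m ^ 2) - 2 * m) = 0 := by linear_combination h
    have h1 : s * (1 + m ^ 2) = 2 * m := by
      rcases mul_eq_zero.1 this with h | h <;> linarith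
    exact ⟨h1, by linear_combination m * h1⟩
  obtain ⟨a1, a2⟩ := e1 h hs hm
  obtain ⟨b1, b2⟩ := e1 h' hs' hm'
  calc (s * k' - k * s') * ((1 + m ^ 2) * (1 + m' ^ 2))
      = (s * (1 + m ^ 2)) * (k' * (1 + m' ^ 2)) - (k * (1 + m ^ 2)) * (s' * (1 + m' ^ 2)) := by ring
    _ = _ := by rw [a1, a2, b1, b2]; ring

/-- One application of the outer length billiard about `K`, from `x` to `y`, in vector form:
the billiard triangle touches `K` at `l`, `r`, `q`, the unit vectors `u`, `v`, `w` are the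
directions of its sides (with `K` on the left), and `ρ` is the radius of the auxiliary circle. -/
structure Step (K : Set ℂ) (x y l r q u v w : ℂ) (a b a' b' ρ : ℝ) : Prop where
  l_mem : l ∈ K
  r_mem : r ∈ K
  q_mem : q ∈ K
  norm_u : ‖u‖ = 1
  norm_v : ‖v‖ = 1
  norm_w : ‖w‖ = 1
  a_pos : 0 < a
  b_pos : 0 < b
  a'_pos : 0 < a'
  b'_pos : 0 < b'
  ρ_pos : 0 < ρ
  x_eq : x = l + a * u
  r_eq : r = x + b * v
  y_eq : y = r + a' * v
  q_eq : q = y + b' * w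
  left_u : ∀ z ∈ K, 0 ≤ cross u (z - l)
  left_v : ∀ z ∈ K, 0 ≤ cross v (z - r)
  left_w : ∀ z ∈ K, 0 ≤ cross w (z - q)
  unique : ∀ z ∈ K, cross v (z - r) = 0 → z = r
  cross_uv : 0 < cross u v
  cross_vw : 0 < cross v w
  tangent_u : b * cross u v = ρ * (1 + dot u v)
  tangent_w : a' * cross v w = ρ * (1 + dot v w)

lemma cross_neg_left (a b : ℂ) : cross (-a) b = - cross a b := by simp [cross]; ring

lemma cross_comm (a b : ℂ) : cross a b = - cross b a := by simp [cross]; ring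

/-- Two different lines, both with `K` on the left, which meet the line of `v` at points before
`r` and touch `K` and a circle that touches the line of `v` at `r`, are equal. -/
lemma eq_of_tangent_before {r u v w l q : ℂ} {a b t μ ρ : ℝ} (hu : ‖u‖ = 1) (hv : ‖v‖ = 1)
    (hw : ‖w‖ = 1) (ha : 0 < a) (hμ : 0 < μ) (hρ : 0 < ρ)
    (huv : 0 < cross u v) (hwv : 0 < cross w v)
    (h1 : b * cross u v = ρ * (1 + dot u v)) (h2 : t * cross w v = ρ * (1 + dot w v))
    (hl : l = r - b * v - a * u) (hq : q = r - t * v - μ * w)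
    (hq' : 0 ≤ cross u (q - l)) (hl' : 0 ≤ cross w (l - q)) : b = t ∧ u = w := by
  have e1 := sq_add_sq_of_norm_eq_one hv
  have e2 := dot_sq_add_cross_sq hu hv
  have e3 := dot_sq_add_cross_sq hw hv
  have k0 : cross u w = cross u v * dot w v - dot u v * cross w v := by
    simp only [cross, dot]
    linear_combination (- u.re * w.im + u.im * w.re) * e1
  have k1 := sin_sub_mul_eq (s := cross u v) (k := dot u v) (s' := cross w v)
    (k' := dot w v) (m := b / ρ) (m' := t / ρ) (by linarith) (by linarith) huv hwv
    (by field_simp; linarith) (by field_simp; linarith)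
  rw [← k0] at k1
  have hb : 0 ≤ b := by
    have := abs_le.1 ((abs_dot_le u v).trans (by rw [hu, hv, mul_one]))
    exact le_of_mul_le_mul_right (by rw [h1, zero_mul]; nlinarith) huv
  have ht : 0 ≤ t := by
    have := abs_le.1 ((abs_dot_le w v).trans (by rw [hw, hv, mul_one]))
    exact le_of_mul_le_mul_right (by rw [h2, zero_mul]; nlinarith) hwv
  have q1 : cross u (q - l) = (b - t) * cross u v - μ * cross u w := by
    rw [hl, hq]; simp [cross]; ring
  have q2 : cross w (l - q) = - (b - t) * cross w v + a * cross u w := by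
    rw [hl, hq]; simp [cross]; ring
  rw [q1] at hq'
  rw [q2] at hl'
  have hP : 0 < (1 + (b / ρ) ^ 2) * (1 + (t / ρ) ^ 2) := by positivity
  have hR : 0 < 2 * (1 + b / ρ * (t / ρ)) / ρ := by positivity
  have k2 : cross u w * ((1 + (b / ρ) ^ 2) * (1 + (t / ρ) ^ 2)) =
      (t - b) * (2 * (1 + b / ρ * (t / ρ)) / ρ) := by rw [k1]; ring
  -- `cross u w` has the sign of `t - b`, so either strict inequality puts one contact point on the
  -- wrong side of the other line.
  have hbt : b = t := by
    rcases lt_trichotomy b t with h | h | h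
    · have h3 := mul_pos (sub_pos.2 h) hR
      rw [← k2, mul_pos_iff_of_pos_right hP] at h3
      linarith [mul_pos hμ h3, mul_pos (sub_pos.2 h) huv]
    · exact h
    · have h3 := mul_pos (sub_pos.2 h) hR
      rw [← neg_sub, neg_mul, ← k2, ← neg_mul, mul_pos_iff_of_pos_right hP] at h3
      linarith [mul_pos ha h3, mul_pos (sub_pos.2 h) hwv]
  refine ⟨hbt, ?_⟩
  rw [hbt, sub_self, zero_mul] at k2
  have h0 : cross u w = 0 := (mul_eq_zero.1 k2).resolve_right (by positivity)
  rcases eq_or_eq_neg_of_cross_eq_zero hu hw h0 with h | h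
  · exact h.symm
  · rw [h, cross_neg_left] at hwv
    linarith

/-- The geometric construction leaves the orientation and position of `ℓ₃` open. Two spurious
configurations must be excluded: `ℓ₃` separating `K` from the circle, which would make it parallel
to `ℓ₂`, and `ℓ₃` meeting `ℓ₂` before `r`, which would make it `ℓ₁`. -/
theorem exists_step {K : Set ℂ} (hK : K.Nontrivial) {x y : ℂ} (h : IsImage K x y) :
    ∃ (l r q u v w : ℂ) (a b a' b' ρ : ℝ), Step K x y l r q u v w a b a' b' ρ := by
  obtain ⟨hx, l, r, c, ρ, ℓ₃, ⟨hl, hlx⟩, ⟨hr, hxr, huniq⟩, ⟨hρ, hrc, hrball, h1⟩, h3K, h3C,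
    hne1, hne2, hy2, hy3⟩ := h
  obtain ⟨a, ha, u, hu, hxl⟩ := exists_eq_add_mul_unit (show l ≠ x from fun h => hx (h ▸ hl))
  obtain ⟨b, hb, v, hv, hrx⟩ := exists_eq_add_mul_unit (show x ≠ r from fun h => hx (h ▸ hr))
  have ev := sq_add_sq_of_norm_eq_one hv
  have left_u : ∀ z ∈ K, 0 ≤ cross u (z - l) := by
    intro z hz
    have := hlx z hz
    rw [hxl, add_sub_cancel_left, cross_smul_left] at this
    exact nonneg_of_mul_nonneg_right this ha
  have left_v : ∀ z ∈ K, 0 ≤ cross v (z - r) := by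
    intro z hz
    have := hxr z hz
    rw [hrx, add_sub_cancel_left, cross_smul_left] at this
    have h2 := nonneg_of_mul_nonneg_right this hb
    have h3 : cross v (z - r) = cross v (z - x) := by rw [hrx]; simp [cross]; ring
    rwa [h3]
  have line2 : ∀ z, z ∈ line[ℝ, x, r] ↔ cross v (z - r) = 0 := by
    intro z
    have h3 : cross v (z - r) = cross v (z - x) := by rw [hrx]; simp [cross]; ring
    rw [h3, hrx, mem_line_add_mul_iff hb.ne' hv]
  have line1 : ∀ z, z ∈ line[ℝ, x, l] ↔ cross u (z - l) = 0 := by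
    intro z
    rw [show line[ℝ, x, l] = line[ℝ, l, x] by rw [Set.pair_comm], hxl,
      mem_line_add_mul_iff ha.ne' hu]
  have uniq : ∀ z ∈ K, cross v (z - r) = 0 → z = r := by
    intro z hz h
    have : z ∈ (line[ℝ, x, r] : Set ℂ) ∩ K := ⟨(line2 z).2 h, hz⟩
    rw [huniq] at this
    exact this
  -- the centre of the circle
  have hc : c = r - ρ * I * v := by
    have h2 : cross (-v) (c - r) = ρ := by
      refine cross_center_eq_radius hρ (by rwa [norm_neg]) (fun z hz => ?_)
        ⟨r, hrc, by simp [cross]⟩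
      have := hrball z hz
      rw [show x - r = b * (-v) by rw [hrx]; ring, cross_smul_left] at this
      exact nonneg_of_mul_nonneg_right this hb
    rw [mem_closedBall, dist_eq_norm, norm_sub_rev] at hrc
    have h3 := sq_dot_add_sq_cross v (c - r)
    rw [cross_neg_left] at h2
    have h4 : dot v (c - r) = 0 := by
      have : dot v (c - r) ^ 2 ≤ 0 := by
        rw [hv] at h3
        nlinarith [norm_nonneg (c - r)]
      exact pow_eq_zero_iff (two_ne_zero) |>.1 (le_antisymm this (sq_nonneg _))
    simp [cross, dot] at h2 h4
    apply Complex.ext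
    · simp
      linear_combination (-(c.re - r.re)) * ev + v.im * h2 + v.re * h4
    · simp
      linear_combination (-(c.im - r.im)) * ev - v.re * h2 + v.im * h4
  have tangent : ∀ w y, ‖w‖ = 1 → cross w (c - y) = -cross w (y - r) - ρ * dot w v := by
    intro w y hw
    rw [hc]; simp [cross, dot]; ring
  -- the side of `ℓ₂` on which `l` lies
  have huv : 0 < cross u v := by
    have h2 : cross v (l - r) = a * cross u v := by rw [hrx, hxl]; simp [cross]; ring
    have h3 := left_v l hl
    rw [h2] at h3
    refine lt_of_le_of_ne (nonneg_of_mul_nonneg_right h3 ha) fun h0 => ?_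
    have hlr := uniq l hl (by rw [h2, ← h0, mul_zero])
    have h4 : (a : ℂ) * u + b * v = 0 := by rw [hlr] at hxl; rw [hxl] at hrx; linear_combination -hrx
    obtain ⟨-, h5⟩ := pos_mul_unit_injective ha hb hu (by rwa [norm_neg])
      (show (a : ℂ) * u = b * (-v) by linear_combination h4)
    -- With `u = -v`, the set `K` would lie on the line `ℓ₂` and hence be the single point `r`.
    obtain ⟨z, hz, hzr⟩ := hK.exists_ne r
    refine hzr (uniq z hz (le_antisymm ?_ (left_v z hz)))
    have := left_u z hz
    rw [h5, cross_neg_left, hlr] at this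
    linarith
  -- tangency of `ℓ₁`
  have t1 : b * cross u v = ρ * (1 + dot u v) := by
    obtain ⟨a₀, w, hw, hline, hball, hmeet⟩ := h1.exists_unit
    have hcr := cross_center_eq_radius hρ hw hball hmeet
    have hl0 : cross w (l - a₀) = 0 := (hline l).1 ((line1 l).2 (by simp [cross]))
    have hcl : cross w (c - l) = ρ := by
      rw [← hcr]; simp [cross] at hl0 ⊢; linarith
    have hu1 := tangent u l hu
    have hul : cross u (l - r) = - b * cross u v := by rw [hrx, hxl]; simp [cross]; ring
    rw [hul] at hu1
    have hdot := abs_le.1 ((abs_dot_le u v).trans (by rw [hu, hv, mul_one]))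
    rcases eq_or_eq_neg_of_same_line hu hw (fun z => (line1 z).symm.trans (hline z)) with h | h
    · rw [h, hu1] at hcl; linarith
    · rw [h, cross_neg_left, hu1] at hcl
      nlinarith [mul_pos hb huv]
  -- the third line
  obtain ⟨a₁, w, hw, hline, hleft, q, hq, hq0⟩ := h3K.exists_unit
  obtain ⟨a₂, w', hw', hline', hball, hmeet⟩ := h3C.exists_unit
  have hcr := cross_center_eq_radius hρ hw' hball hmeet
  have shift : ∀ {w a p : ℂ}, cross w (p - a) = 0 → ∀ z, cross w (z - a) = cross w (z - p) := by
    intro w a p h z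
    simp [cross] at h ⊢; linarith
  have hyw : cross w (y - a₁) = 0 := (hline y).1 hy3
  have hyw' : cross w' (y - a₂) = 0 := (hline' y).1 hy3
  have hyv : cross v (y - r) = 0 := (line2 y).1 hy2
  set t := dot v (y - r) with ht
  have hy : y = r + t * v := by
    have := eq_mul_of_cross_eq_zero hv hyv
    rw [← ht] at this
    linear_combination this
  have hvw : cross v w ≠ 0 := by
    intro h0
    refine hne2 ?_
    ext z
    rw [hline, line2, shift hyw, shift hyv]
    rcases eq_or_eq_neg_of_cross_eq_zero hv hw h0 with h | h
    · rw [h]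
    · rw [h, cross_neg_left, neg_eq_zero]
  have hcy : cross w' (c - y) = ρ := by rw [← shift hyw', hcr]
  -- If `K` and the circle were on opposite sides of `ℓ₃`, their common point `r` would lie on `ℓ₃`.
  -- Then `ℓ₃` would be tangent to the circle at `r`, hence parallel to `ℓ₂`.
  have hww : w' = w := by
    rcases eq_or_eq_neg_of_same_line hw hw' (fun z => (hline z).symm.trans (hline' z)) with h | h
    · exact h
    exfalso
    have h2 := hball r hrc
    have h3 := hleft r hr
    rw [shift hyw', h, cross_neg_left] at h2
    rw [shift hyw] at h3
    have h4 : cross w (r - y) = 0 := by linarith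
    have h5 := tangent w y hw
    rw [h, cross_neg_left] at hcy
    have h6 : cross w (y - r) = 0 := by simp [cross] at h4 ⊢; linarith
    have h7 : dot w v = 1 := by
      have : ρ * dot w v = ρ := by linarith
      field_simp at this; linarith
    have h8 := dot_sq_add_cross_sq hw hv
    rw [h7] at h8
    have h9 : cross w v = 0 := by nlinarith
    rw [cross_comm, neg_eq_zero] at h9
    exact hvw h9
  rw [hww, tangent w y hw] at hcy
  have t2 : t * cross v w = ρ * (1 + dot v w) := by
    have h2 : cross w (y - r) = - t * cross v w := by rw [hy]; simp [cross]; ring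
    have h3 : dot w v = dot v w := by simp [dot]; ring
    rw [h2, h3] at hcy
    linarith
  have hqy : cross w (q - y) = 0 := by rw [← shift hyw, hq0]
  set μ := dot w (q - y) with hμ
  have hqy' : q = y + μ * w := by
    have := eq_mul_of_cross_eq_zero hw hqy
    rw [← hμ] at this
    linear_combination this
  have hleft' : ∀ z ∈ K, 0 ≤ cross w (z - q) := by
    intro z hz
    rw [← shift hq0]; exact hleft z hz
  have hqr : cross v (q - r) = μ * cross v w := by rw [hqy', hy]; simp [cross]; ring
  have hqv := left_v q hq
  have hvw2 := dot_sq_add_cross_sq hv hw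
  have hdot : 0 < 1 + dot v w := by
    have : 0 < cross v w ^ 2 := by positivity
    nlinarith
  have hμ0 : μ ≠ 0 := by
    intro h0
    have h2 := uniq q hq (by rw [hqr, h0, zero_mul])
    have h3 : (t : ℂ) * v = 0 := by
      rw [h0] at hqy'; rw [h2, hy] at hqy'; push_cast at hqy'; linear_combination -hqy'
    have h4 : t = 0 := by
      have := congrArg norm h3
      simpa [hv] using this
    rw [h4] at t2
    nlinarith
  rcases lt_or_gt_of_ne hvw with hneg | hpos
  · exfalso
    have hwv : 0 < cross w v := by rw [cross_comm]; linarith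
    have hμn : μ < 0 := by
      refine lt_of_le_of_ne ?_ hμ0
      by_contra! hc
      rw [hqr] at hqv
      nlinarith
    obtain ⟨h2, h3⟩ := eq_of_tangent_before (r := r) (l := l) (q := q) (b := b) (t := -t) (a := a)
      (μ := -μ) hu hv hw ha (by linarith) hρ huv hwv t1
      (by rw [cross_comm w v, show dot w v = dot v w by simp [dot]; ring]; linarith)
      (by rw [hrx, hxl]; ring) (by rw [hqy', hy]; push_cast; ring) (left_u q hq) (hleft' l hl)
    refine hne1 ?_
    have hyx : y = x := by rw [hy, hrx, h2]; push_cast; ring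
    ext z
    rw [hline, line1, shift hyw, hyx, ← h3]
    have : cross u (x - l) = 0 := by rw [hxl]; simp [cross]; ring
    rw [shift this]
  · have htp : 0 < t := by
      by_contra! hc
      nlinarith [mul_pos hρ hdot]
    have hμp : 0 < μ := by
      refine lt_of_le_of_ne ?_ hμ0.symm
      rw [hqr] at hqv
      exact nonneg_of_mul_nonneg_left hqv hpos
    exact ⟨l, r, q, u, v, w, a, b, t, μ, ρ, hl, hr, hq, hu, hv, hw, ha, hb, htp, hμp, hρ, hxl, hrx,
      hy, hqy', left_u, left_v, hleft', uniq, huv, hpos, t1, t2⟩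

/-! ### Estimates for a single step. -/

lemma norm_sq_add (u v : ℂ) : ‖u + v‖ ^ 2 = ‖u‖ ^ 2 + 2 * dot u v + ‖v‖ ^ 2 := by
  simp only [Complex.sq_norm, Complex.normSq_apply, dot, add_re, add_im]
  ring

lemma arcsin_le_mul {s : ℝ} (h0 : 0 ≤ s) (h1 : s ≤ 1) : Real.arcsin s ≤ Real.pi / 2 * s := by
  have h2 := Real.mul_le_sin (Real.arcsin_nonneg.2 h0) (Real.arcsin_le_pi_div_two s)
  rw [Real.sin_arcsin (by linarith) h1] at h2
  have h3 := Real.pi_pos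
  calc Real.arcsin s = Real.pi / 2 * (2 / Real.pi * Real.arcsin s) := by field_simp
    _ ≤ _ := by gcongr

lemma cross_mem_Icc {u v : ℂ} (hu : ‖u‖ = 1) (hv : ‖v‖ = 1) : -1 ≤ cross u v ∧ cross u v ≤ 1 :=
  abs_le.1 ((abs_cross_le u v).trans (by rw [hu, hv, mul_one]))

lemma dot_mem_Icc {u v : ℂ} (hu : ‖u‖ = 1) (hv : ‖v‖ = 1) : -1 ≤ dot u v ∧ dot u v ≤ 1 :=
  abs_le.1 ((abs_dot_le u v).trans (by rw [hu, hv, mul_one]))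

lemma cos_arcsin_cross {u v : ℂ} (hu : ‖u‖ = 1) (hv : ‖v‖ = 1) (h : dot u v ≤ 0) :
    Real.cos (Real.arcsin (cross u v)) = -dot u v := by
  have h1 := dot_sq_add_cross_sq hu hv
  rw [Real.cos_arcsin, show 1 - cross u v ^ 2 = (-dot u v) ^ 2 by linarith,
    Real.sqrt_sq (by linarith)]

/-- Chord at most arc: the arcsine is the angle from `-u` to `v`. -/
lemma norm_add_le_arcsin {u v : ℂ} (hu : ‖u‖ = 1) (hv : ‖v‖ = 1) (h : dot u v ≤ 0)
    (h' : 0 ≤ cross u v) : ‖u + v‖ ≤ Real.arcsin (cross u v) := by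
  refine abs_le_of_sq_le_sq' ?_ (Real.arcsin_nonneg.2 h') |>.2
  rw [norm_sq_add, hu, hv]
  have h2 := Real.one_sub_sq_div_two_le_cos (x := Real.arcsin (cross u v))
  rw [cos_arcsin_cross hu hv h] at h2
  linarith

/-- Turning by the angle between `-u` and `v`. -/
lemma eq_neg_exp_mul {u v : ℂ} (hu : ‖u‖ = 1) (hv : ‖v‖ = 1) (h : dot u v ≤ 0) :
    v = -(exp (-(Real.arcsin (cross u v) : ℝ) * I) * u) := by
  have h1 := sq_add_sq_of_norm_eq_one hu
  have h2 := cos_arcsin_cross hu hv h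
  have h3 := Real.sin_arcsin (cross_mem_Icc hu hv).1 (cross_mem_Icc hu hv).2
  rw [← ofReal_neg, exp_mul_I, ← ofReal_cos, ← ofReal_sin, Real.cos_neg, Real.sin_neg, h2, h3]
  apply Complex.ext
  · simp [dot, cross]
    linear_combination (-v.re) * h1
  · simp [dot, cross]
    linear_combination (-v.im) * h1

lemma eq_norm_sub_of_eq_add {a b u : ℂ} {t : ℝ} (ht : 0 < t) (hu : ‖u‖ = 1) (h : b = a + t * u) :
    t = ‖b - a‖ := by
  rw [h, add_sub_cancel_left, norm_mul, hu, Complex.norm_real, Real.norm_of_nonneg ht.le, mul_one]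

section Estimates

variable {K : Set ℂ} {x y l r q u v w : ℂ} {a b a' b' ρ d : ℝ}

lemma Step.bounds_start (S : Step K x y l r q u v w a b a' b' ρ) (hd : ∀ z ∈ K, ‖z‖ ≤ d) :
    ‖x‖ - d ≤ a ∧ a ≤ ‖x‖ + d ∧ ‖x‖ - d ≤ b ∧ b ≤ ‖x‖ + d := by
  have e1 := eq_norm_sub_of_eq_add S.a_pos S.norm_u S.x_eq
  have e2 := eq_norm_sub_of_eq_add S.b_pos S.norm_v S.r_eq
  have h1 := hd l S.l_mem
  have h2 := hd r S.r_mem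
  have h3 := norm_sub_norm_le x l
  have h4 := norm_sub_le x l
  have h5 := norm_sub_norm_le x r
  have h6 := norm_sub_le r x
  rw [norm_sub_rev] at h5
  refine ⟨?_, ?_, ?_, ?_⟩ <;> linarith

lemma Step.bounds_end (S : Step K x y l r q u v w a b a' b' ρ) (hd : ∀ z ∈ K, ‖z‖ ≤ d) :
    ‖y‖ - d ≤ b' ∧ a' ≤ ‖y‖ + d ∧ b' ≤ ‖y‖ + d := by
  have e1 := eq_norm_sub_of_eq_add S.a'_pos S.norm_v S.y_eq
  have e2 := eq_norm_sub_of_eq_add S.b'_pos S.norm_w S.q_eq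
  have h1 := hd r S.r_mem
  have h2 := hd q S.q_mem
  have h4 := norm_sub_le y r
  have h5 := norm_sub_norm_le y q
  have h6 := norm_sub_le q y
  rw [norm_sub_rev] at h5
  refine ⟨?_, ?_, ?_⟩ <;> linarith

lemma Step.dot_uv_neg (S : Step K x y l r q u v w a b a' b' ρ)
    (hdiam : ∀ z ∈ K, ∀ z' ∈ K, ‖z - z'‖ ≤ d) (hb : d < b) : dot u v < 0 := by
  have e := sq_add_sq_of_norm_eq_one S.norm_v
  have h1 : dot (r - l) v = a * dot u v + b := by
    rw [S.r_eq, S.x_eq]; simp [dot]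
    linear_combination b * e
  have h2 := (abs_le.1 ((abs_dot_le (r - l) v).trans (by rw [S.norm_v, mul_one]))).2
  have h3 := hdiam r S.r_mem l S.l_mem
  have := S.a_pos
  by_contra! hc
  nlinarith

/-- Otherwise `a' ≤ d`, while the half-angle formulas for the tangent lengths give `b ≤ ρ` (obtuse
turn at `x`) and `ρ ≤ a'` (non-obtuse turn at `y`), contradicting `d < b`. -/
lemma Step.dot_vw_neg (S : Step K x y l r q u v w a b a' b' ρ)
    (hdiam : ∀ z ∈ K, ∀ z' ∈ K, ‖z - z'‖ ≤ d) (hb : d < b) : dot v w < 0 := by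
  have huv := S.dot_uv_neg hdiam hb
  have e := sq_add_sq_of_norm_eq_one S.norm_v
  have h1 : dot (q - r) v = a' + b' * dot v w := by
    rw [S.q_eq, S.y_eq]; simp [dot]
    linear_combination a' * e
  have h2 := (abs_le.1 ((abs_dot_le (q - r) v).trans (by rw [S.norm_v, mul_one]))).2
  have h3 := hdiam q S.q_mem r S.r_mem
  by_contra! hc
  have h4 : a' ≤ d := by nlinarith [S.b'_pos]
  have k1 := dot_sq_add_cross_sq S.norm_u S.norm_v
  have k2 := dot_sq_add_cross_sq S.norm_v S.norm_w
  have s1 := S.cross_uv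
  have s2 := S.cross_vw
  have hρ := S.ρ_pos
  have d1 := dot_mem_Icc S.norm_u S.norm_v
  have d2 := dot_mem_Icc S.norm_v S.norm_w
  have h5 : 1 + dot u v ≤ cross u v := by
    apply abs_le_of_sq_le_sq' _ s1.le |>.2
    nlinarith
  have h6 : cross v w ≤ 1 + dot v w := by
    apply abs_le_of_sq_le_sq' _ (by linarith) |>.2
    nlinarith
  have h7 : b ≤ ρ := by
    have := S.tangent_u
    by_contra! h
    nlinarith
  have h8 : ρ ≤ a' := by
    have := S.tangent_w
    by_contra! h
    nlinarith
  linarith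

/-- The two tangent lengths from the apex of the billiard triangle to the auxiliary circle
agree. -/
lemma Step.exists_decomp (S : Step K x y l r q u v w a b a' b' ρ)
    (hdiam : ∀ z ∈ K, ∀ z' ∈ K, ‖z - z'‖ ≤ d) (hb : d < b) :
    ∃ s t : ℝ, 0 ≤ s ∧ 0 ≤ t ∧ l - q = s * u + t * w ∧ (a + b) - (a' + b') = t - s := by
  have huv := S.dot_uv_neg hdiam hb
  have hvw := S.dot_vw_neg hdiam hb
  have s1 := S.cross_uv
  have s2 := S.cross_vw
  have ev := sq_add_sq_of_norm_eq_one S.norm_v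
  -- The sine of the apex angle between `ℓ₁` and `ℓ₃`; its positivity places the apex on the side of
  -- `ℓ₂` where `K` lies.
  set σ := -(cross u v * dot v w + dot u v * cross v w) with hσ
  have σpos : 0 < σ := by
    have := mul_pos s1 (neg_pos.2 hvw)
    have := mul_pos (neg_pos.2 huv) s2
    linarith
  have huw : cross u w = -σ := by
    simp only [hσ, cross, dot]
    linear_combination (-(u.re * w.im - u.im * w.re)) * ev
  have σne : (σ : ℂ) ≠ 0 := by exact_mod_cast σpos.ne'
  have hql : q - l = a * u + (b + a') * v + b' * w := by
    rw [S.q_eq, S.y_eq, S.r_eq, S.x_eq]; ring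
  have g1 := S.left_u q S.q_mem
  have g2 := S.left_w l S.l_mem
  have f1 : cross u (q - l) = (b + a') * cross u v - b' * σ := by
    rw [hql, ← neg_eq_iff_eq_neg.2 huw]; simp [cross]; ring
  have f2 : cross w (l - q) = (b + a') * cross v w - a * σ := by
    rw [← neg_sub, hql, ← neg_eq_iff_eq_neg.2 huw]; simp [cross]; ring
  rw [f1] at g1
  rw [f2] at g2
  have hρ := S.ρ_pos
  have t1 := S.tangent_u
  have t2 := S.tangent_w
  have k1 := dot_sq_add_cross_sq S.norm_u S.norm_v
  have k2 := dot_sq_add_cross_sq S.norm_v S.norm_w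
  have t1' : b * (1 - dot u v) = ρ * cross u v := by
    apply mul_right_cancel₀ s1.ne'
    linear_combination (1 - dot u v) * t1 - ρ * k1
  have t2' : a' * (1 - dot v w) = ρ * cross v w := by
    apply mul_right_cancel₀ s2.ne'
    linear_combination (1 - dot v w) * t2 - ρ * k2
  have key : (b - a') * σ = (b + a') * (cross u v - cross v w) := by
    rw [hσ]
    linear_combination (-(1 + dot v w)) * t1 + cross v w * t1' - cross u v * t2' +
      (1 + dot u v) * t2
  have vec : cross v w * u + cross u v * w = -(σ * v) := by
    have : (-(σ * v) : ℂ) = cross u w * v := by rw [huw]; push_cast; ring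
    rw [this]
    apply Complex.ext <;> simp [cross] <;> ring
  -- The law of sines gives the sides from the apex to `x` and to `y`; subtracting `a` and `b'`
  -- leaves the distances from the apex to `l` and `q`.
  refine ⟨(b + a') * cross v w / σ - a, (b + a') * cross u v / σ - b', ?_, ?_, ?_, ?_⟩
  · rw [sub_nonneg, le_div_iff₀ σpos]; linarith
  · rw [sub_nonneg, le_div_iff₀ σpos]; linarith
  · rw [← neg_sub, hql]
    push_cast
    field_simp
    linear_combination (-(b + a' : ℂ)) * vec
  · field_simp
    linear_combination key

lemma Step.abs_sub_le (S : Step K x y l r q u v w a b a' b' ρ)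
    (hdiam : ∀ z ∈ K, ∀ z' ∈ K, ‖z - z'‖ ≤ d) (hb : d < b) :
    |(a + b) - (a' + b')| ≤ d := by
  obtain ⟨s, t, hs, ht, h1, h2⟩ := S.exists_decomp hdiam hb
  have h3 := hdiam l S.l_mem q S.q_mem
  have h4 := abs_norm_sub_norm_le ((t : ℂ) * w) (-(s * u))
  rw [sub_neg_eq_add, add_comm, ← h1, norm_neg, norm_mul, norm_mul, S.norm_w, S.norm_u,
    Complex.norm_real, Complex.norm_real, Real.norm_of_nonneg hs, Real.norm_of_nonneg ht, mul_one,
    mul_one, ← h2] at h4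
  exact h4.trans h3

/-- The angle between the support lines at a point far away is small. -/
lemma Step.arcsin_uv_le (S : Step K x y l r q u v w a b a' b' ρ) (hd0 : 0 < d)
    (hdiam : ∀ z ∈ K, ∀ z' ∈ K, ‖z - z'‖ ≤ d) (ha : 7 * d ≤ a) :
    Real.arcsin (cross u v) ≤ 9 / 40 := by
  have h1 : cross v (l - r) = a * cross u v := by rw [S.r_eq, S.x_eq]; simp [cross]; ring
  have h2 := (abs_le.1 ((abs_cross_le v (l - r)).trans (by rw [S.norm_v, one_mul]))).2
  have h3 := hdiam l S.l_mem r S.r_mem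
  have h4 := S.cross_uv
  have h5 : cross u v ≤ 1 / 7 := by
    rw [h1] at h2
    by_contra! hc
    nlinarith
  have h6 := arcsin_le_mul h4.le (by linarith)
  have := Real.pi_lt_d2
  nlinarith [Real.pi_pos]

/-- A crude a priori bound: it keeps the next point far enough away to control the second turning
angle before the finer estimate is available. -/
lemma Step.norm_end_ge (S : Step K x y l r q u v w a b a' b' ρ) (hd0 : 0 < d)
    (hd : ∀ z ∈ K, ‖z‖ ≤ d) (hdiam : ∀ z ∈ K, ∀ z' ∈ K, ‖z - z'‖ ≤ d) (hx : 8 * d ≤ ‖x‖) :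
    ‖x‖ - 5 / 2 * d ≤ ‖y‖ := by
  obtain ⟨h1, -, h2, -⟩ := S.bounds_start hd
  obtain ⟨-, h3, h4⟩ := S.bounds_end hd
  have := abs_le.1 (S.abs_sub_le hdiam (by linarith))
  linarith

lemma Step.arcsin_vw_le (S : Step K x y l r q u v w a b a' b' ρ) (hd0 : 0 < d)
    (hd : ∀ z ∈ K, ‖z‖ ≤ d) (hdiam : ∀ z ∈ K, ∀ z' ∈ K, ‖z - z'‖ ≤ d) (hx : 8 * d ≤ ‖x‖) :
    Real.arcsin (cross v w) ≤ 7 / 20 := by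
  have hb := (S.bounds_end hd).1
  have hy := S.norm_end_ge hd0 hd hdiam hx
  have h1 : cross v (q - r) = b' * cross v w := by rw [S.q_eq, S.y_eq]; simp [cross]; ring
  have h2 := (abs_le.1 ((abs_cross_le v (q - r)).trans (by rw [S.norm_v, one_mul]))).2
  have h3 := hdiam q S.q_mem r S.r_mem
  have h4 := S.cross_vw
  have h5 : cross v w ≤ 2 / 9 := by
    rw [h1] at h2
    by_contra! hc
    nlinarith
  have h6 := arcsin_le_mul h4.le (by linarith)
  have := Real.pi_lt_d2
  nlinarith [Real.pi_pos]

/-- The change of the sum of the tangent lengths in one step. -/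
lemma Step.abs_sub_le_turn (S : Step K x y l r q u v w a b a' b' ρ) (hd0 : 0 < d)
    (hd : ∀ z ∈ K, ‖z‖ ≤ d) (hdiam : ∀ z ∈ K, ∀ z' ∈ K, ‖z - z'‖ ≤ d) (hx : 8 * d ≤ ‖x‖) :
    |(a + b) - (a' + b')| ≤ 10 / 9 * (dot l u - dot q w +
      d * (Real.arcsin (cross u v) + Real.arcsin (cross v w))) := by
  obtain ⟨ha, -, hb, -⟩ := S.bounds_start hd
  have hdb : d < b := by linarith
  obtain ⟨s, t, hs, ht, h1, h2⟩ := S.exists_decomp hdiam hdb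
  have huv := S.dot_uv_neg hdiam hdb
  have hvw := S.dot_vw_neg hdiam hdb
  have n1 := norm_add_le_arcsin S.norm_u S.norm_v huv.le S.cross_uv.le
  have n2 := norm_add_le_arcsin S.norm_v S.norm_w hvw.le S.cross_vw.le
  have m1 := S.arcsin_uv_le hd0 hdiam (by linarith)
  have m2 := S.arcsin_vw_le hd0 hd hdiam hx
  set δ := Real.arcsin (cross u v) + Real.arcsin (cross v w) with hδ
  have n3 : ‖u - w‖ ≤ δ := by
    rw [show u - w = (u + v) - (v + w) by ring]
    linarith [norm_sub_le (u + v) (v + w)]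
  have e1 := sq_add_sq_of_norm_eq_one S.norm_u
  have e2 := sq_add_sq_of_norm_eq_one S.norm_w
  have n4 : ‖u - w‖ ^ 2 = 2 - 2 * dot u w := by
    rw [Complex.sq_norm, Complex.normSq_apply]
    simp [dot]
    linear_combination e1 + e2
  have n5 : 9 / 10 ≤ (1 + dot u w) / 2 := by nlinarith [norm_nonneg (u - w)]
  -- Pairing `s u + t w` with `(u + w) / 2` weights `s` and `t` equally. The remaining term is what
  -- the telescoping quantity picks up from the rotation of `u` to `w`.
  have id1 : dot l u - dot q w = (s + t) * ((1 + dot u w) / 2) + dot ((l + q) / 2) (u - w) := by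
    have h3 : dot l u - dot q w = dot (l - q) ((u + w) / 2) + dot ((l + q) / 2) (u - w) := by
      simp [dot]; ring
    rw [h3, h1]
    congr 1
    simp [dot]
    linear_combination s / 2 * e1 + t / 2 * e2
  have h4 : ‖(l + q) / 2‖ ≤ d := by
    rw [norm_div, Complex.norm_two]
    linarith [norm_add_le l q, hd l S.l_mem, hd q S.q_mem]
  have h5 := (abs_le.1 (abs_dot_le ((l + q) / 2) (u - w))).1
  have h6 : ‖(l + q) / 2‖ * ‖u - w‖ ≤ d * δ := by gcongr
  have h7 : (s + t) * (9 / 10) ≤ (s + t) * ((1 + dot u w) / 2) := by gcongr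
  rw [h2]
  refine (abs_le.2 ⟨?_, ?_⟩ : |t - s| ≤ s + t).trans ?_ <;> linarith

end Estimates

/-! ### Orbits as sequences of support lines. -/

/-- The end of a step is the start of the next one, with the same support lines. -/
lemma Step.glue {K : Set ℂ} {x y l r q u v w l₂ r₂ q₂ u₂ v₂ w₂ z : ℂ}
    {a b a' b' ρ a₂ b₂ a₂' b₂' ρ₂ : ℝ} (S : Step K x y l r q u v w a b a' b' ρ)
    (S' : Step K y z l₂ r₂ q₂ u₂ v₂ w₂ a₂ b₂ a₂' b₂' ρ₂) :
    l₂ = r ∧ u₂ = v ∧ a₂ = a' ∧ r₂ = q ∧ v₂ = w ∧ b₂ = b' := by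
  have y1 := S.y_eq
  have y2 := S'.x_eq
  have h1 : l₂ = r := by
    have e : l₂ - r = a' * v - a₂ * u₂ := by linear_combination y1 - y2
    have c1 := S.left_v l₂ S'.l_mem
    have c2 := S'.left_u r S.r_mem
    have f1 : cross v (l₂ - r) = a₂ * cross u₂ v := by rw [e]; simp [cross]; ring
    have f2 : cross u₂ (r - l₂) = -(a' * cross u₂ v) := by rw [← neg_sub, e]; simp [cross]; ring
    have c3 : cross u₂ v = 0 := by
      rw [f1] at c1
      rw [f2] at c2
      exact le_antisymm (by by_contra! h; linarith [mul_pos S.a'_pos h])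
        (nonneg_of_mul_nonneg_right c1 S'.a_pos)
    exact S.unique _ S'.l_mem (by rw [f1, c3, mul_zero])
  have h2 : r₂ = q := by
    have e1 := S'.r_eq
    have e2 := S.q_eq
    have c1 := S.left_w r₂ S'.r_mem
    have c2 := S'.left_v q S.q_mem
    have f1 : cross w (r₂ - q) = -(b₂ * cross v₂ w) := by rw [e1, e2]; simp [cross]; ring
    have f2 : cross v₂ (q - r₂) = b' * cross v₂ w := by rw [e1, e2]; simp [cross]; ring
    have c3 : cross v₂ w = 0 := by
      rw [f1] at c1
      rw [f2] at c2
      exact le_antisymm (by by_contra! h; linarith [mul_pos S'.b_pos h])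
        (nonneg_of_mul_nonneg_right c2 S.b'_pos)
    exact (S'.unique _ S.q_mem (by rw [f2, c3, mul_zero])).symm
  obtain ⟨h3, h4⟩ := pos_mul_unit_injective S'.a_pos S.a'_pos S'.norm_u S.norm_v
    (by rw [h1] at y2; linear_combination y1 - y2)
  obtain ⟨h5, h6⟩ := pos_mul_unit_injective S'.b_pos S.b'_pos S'.norm_v S.norm_w
    (by linear_combination S.q_eq - S'.r_eq + h2)
  exact ⟨h1, h4, h3, h2, h6, h5⟩

/-- The vector form of an orbit: `p k` are the points of contact of the consecutive support lines,
`u k` their directions, `a k` and `b k` the lengths of the tangents from the `k`-th point. -/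
def IsOrbit (K : Set ℂ) (X p u : ℕ → ℂ) (a b ρ : ℕ → ℝ) : Prop :=
  ∀ k, Step K (X k) (X (k + 1)) (p k) (p (k + 1)) (p (k + 2)) (u k) (u (k + 1)) (u (k + 2))
    (a k) (b k) (a (k + 1)) (b (k + 1)) (ρ k)

lemma exists_isOrbit {K : Set ℂ} (hK : K.Nontrivial) {x : ℂ} (hx : x ∈ domain K) :
    ∃ (p u : ℕ → ℂ) (a b ρ : ℕ → ℝ), IsOrbit K (fun k => (billiardMap K)^[k] x) p u a b ρ := by
  have h : ∀ k, ∃ (l r q u v w : ℂ) (a b a' b' ρ : ℝ),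
      Step K ((billiardMap K)^[k] x) ((billiardMap K)^[k + 1] x) l r q u v w a b a' b' ρ := by
    intro k
    apply exists_step hK
    have h := hx k
    rw [Function.iterate_succ_apply', billiardMap, dif_pos h]
    exact h.choose_spec
  choose l r q u v w a b a' b' ρ S using h
  refine ⟨l, u, a, b, ρ, fun k => ?_⟩
  obtain ⟨h1, h2, h3, h4, h5, h6⟩ := (S k).glue (S (k + 1))
  obtain ⟨h7, h8, -⟩ := (S (k + 1)).glue (S (k + 2))
  have := S k
  rw [← h4, ← h7, ← h1, ← h5, ← h8, ← h2, ← h3, ← h6] at this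
  exact this

/-! ### Arguments of points, and the turning of the support lines. -/

lemma div_im_eq (x z : ℂ) : (z / x).im = cross x z / normSq x := by
  rw [Complex.div_im, cross]; ring

lemma polarArg_pos {x z : ℂ} (h : 0 < cross x z) : 0 < polarArg x z := by
  have hx : x ≠ 0 := by rintro rfl; simp [cross] at h
  have him : 0 < (z / x).im := by
    rw [div_im_eq]; exact div_pos h (Complex.normSq_pos.2 hx)
  rw [polarArg, if_neg (fun h => him.ne' (Complex.arg_eq_pi_iff.1 h).2)]
  exact lt_of_le_of_ne (Complex.arg_nonneg_iff.2 him.le)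
    (fun h => him.ne' (Complex.arg_eq_zero_iff.1 h.symm).2)

lemma polarArg_neg {x z : ℂ} (h : cross x z < 0) : polarArg x z < 0 := by
  have hx : x ≠ 0 := by rintro rfl; simp [cross] at h
  have him : (z / x).im < 0 := by
    rw [div_im_eq]; exact div_neg_of_neg_of_pos h (Complex.normSq_pos.2 hx)
  rw [polarArg, if_neg (fun h => him.ne (Complex.arg_eq_pi_iff.1 h).2)]
  exact Complex.arg_neg_iff.2 him

lemma abs_cross_sub_le {p p' u u' : ℂ} {a a' d : ℝ} (hd : 0 < d) (hp : ‖p‖ ≤ d) (hp' : ‖p'‖ ≤ d)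
    (hu : ‖u‖ = 1) (hu' : ‖u'‖ = 1) (ha : 7 * d ≤ a) (ha' : 7 * d ≤ a') :
    |cross (p + a * u) (p' + a' * u') - a * a' * cross u u'| ≤ 15 / 49 * (a * a') := by
  have e : cross (p + a * u) (p' + a' * u') - a * a' * cross u u' =
      cross p p' + a' * cross p u' + a * cross u p' := by simp [cross]; ring
  have h1 : |cross p p'| ≤ d * d := (abs_cross_le _ _).trans (by gcongr)
  have h2 : |cross p u'| ≤ d := (abs_cross_le _ _).trans (by rw [hu', mul_one]; exact hp)
  have h3 : |cross u p'| ≤ d := (abs_cross_le _ _).trans (by rw [hu, one_mul]; exact hp')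
  have h4 : |a' * cross p u'| ≤ a' * d := by
    rw [abs_mul, abs_of_pos (by linarith)]; gcongr; linarith
  have h5 : |a * cross u p'| ≤ a * d := by
    rw [abs_mul, abs_of_pos (by linarith)]; gcongr; linarith
  rw [e]
  refine (abs_add_three _ _ _).trans ?_
  have h6 := mul_nonneg (sub_nonneg.2 ha) (sub_nonneg.2 ha')
  nlinarith [mul_nonneg (sub_nonneg.2 ha) hd.le, mul_nonneg (sub_nonneg.2 ha') hd.le,
    mul_nonneg (sub_nonneg.2 ha) (show 0 ≤ a' by linarith),
    mul_nonneg (sub_nonneg.2 ha') (show 0 ≤ a by linarith)]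

/-- The angle through which the support line has turned after `k` steps. -/
noncomputable def turn (u : ℕ → ℂ) (k : ℕ) : ℝ :=
  ∑ i ∈ Finset.range k, Real.arcsin (cross (u i) (u (i + 1)))

lemma turn_succ (u : ℕ → ℂ) (k : ℕ) :
    turn u (k + 1) = turn u k + Real.arcsin (cross (u k) (u (k + 1))) :=
  Finset.sum_range_succ _ _

@[simp] lemma turn_zero (u : ℕ → ℂ) : turn u 0 = 0 := Finset.sum_range_zero _

section Orbit

variable {K : Set ℂ} {X p u : ℕ → ℂ} {a b ρ : ℕ → ℝ} {d : ℝ}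

lemma IsOrbit.monotone_turn (O : IsOrbit K X p u a b ρ) : Monotone (turn u) :=
  monotone_nat_of_le_succ fun k => by
    rw [turn_succ]
    linarith [Real.arcsin_nonneg.2 (O k).cross_uv.le]

lemma IsOrbit.abs_dot_le (O : IsOrbit K X p u a b ρ) (hd : ∀ z ∈ K, ‖z‖ ≤ d) (k : ℕ) :
    |dot (p k) (u k)| ≤ d :=
  (OuterLength.abs_dot_le _ _).trans (by rw [(O k).norm_u, mul_one]; exact hd _ (O k).l_mem)

/-- A step advances the contact index by two, so the telescoped sum leaves two boundary terms at
each end, and step `j` contributes the turning angles `j` and `j + 1`. -/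
lemma IsOrbit.abs_tangents_sub_le (O : IsOrbit K X p u a b ρ) (hd0 : 0 < d)
    (hd : ∀ z ∈ K, ‖z‖ ≤ d) (hdiam : ∀ z ∈ K, ∀ z' ∈ K, ‖z - z'‖ ≤ d) (k : ℕ)
    (h : ∀ j < k, 8 * d ≤ ‖X j‖) :
    |(a k + b k) - (a 0 + b 0)| ≤ 10 / 9 * (dot (p 0) (u 0) + dot (p 1) (u 1) - dot (p k) (u k)
      - dot (p (k + 1)) (u (k + 1)) + d * (turn u k + turn u (k + 1) - turn u 1)) := by
  induction k with
  | zero => simp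
  | succ k ih =>
    have h1 := ih fun j hj => h j (by omega)
    have h2 := (O k).abs_sub_le_turn hd0 hd hdiam (h k (by omega))
    rw [abs_sub_comm] at h2
    have h3 := abs_sub_le (a (k + 1) + b (k + 1)) (a k + b k) (a 0 + b 0)
    rw [turn_succ u (k + 1)]
    have h4 := turn_succ u k
    have h5 : d * turn u (k + 1) = d * turn u k + d * Real.arcsin (cross (u k) (u (k + 1))) := by
      rw [h4]; ring
    refine h3.trans ?_
    linarith

lemma IsOrbit.arcsin_le (O : IsOrbit K X p u a b ρ) (hd0 : 0 < d) (hd : ∀ z ∈ K, ‖z‖ ≤ d)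
    (hdiam : ∀ z ∈ K, ∀ z' ∈ K, ‖z - z'‖ ≤ d) {k : ℕ} (h : 8 * d ≤ ‖X k‖) :
    Real.arcsin (cross (u k) (u (k + 1))) ≤ 9 / 40 :=
  (O k).arcsin_uv_le hd0 hdiam (by linarith [((O k).bounds_start hd).1])

/-- Strong induction on `k`: the bound at earlier times gives `‖X j‖ ≥ 8 d`, because the constants
`4π + 11` and `4π + 3` differ by `8`. This is what the one-step estimates need in order to reach
time `k`. -/
lemma IsOrbit.annulus (O : IsOrbit K X p u a b ρ) (hd0 : 0 < d) (hd : ∀ z ∈ K, ‖z‖ ≤ d)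
    (hdiam : ∀ z ∈ K, ∀ z' ∈ K, ‖z - z'‖ ≤ d) (hX : (4 * Real.pi + 11) * d ≤ ‖X 0‖) (k : ℕ)
    (hk : turn u k ≤ 3 * Real.pi) : |‖X k‖ - ‖X 0‖| ≤ (4 * Real.pi + 3) * d := by
  induction k using Nat.strong_induction_on with
  | _ k ih =>
  have hfar : ∀ j < k, 8 * d ≤ ‖X j‖ := fun j hj => by
    have := abs_le.1 (ih j hj ((O.monotone_turn hj.le).trans hk))
    linarith
  have h1 := O.abs_tangents_sub_le hd0 hd hdiam k hfar
  -- `X k` is not yet known to be far away, so for `k > 0` its angle is bounded as the closing angle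
  -- of the previous step.
  have h2 : Real.arcsin (cross (u k) (u (k + 1))) ≤ 7 / 20 := by
    cases k with
    | zero =>
      have := Real.pi_pos
      have := O.arcsin_le hd0 hd hdiam (k := 0) (by nlinarith)
      linarith
    | succ k => exact (O k).arcsin_vw_le hd0 hd hdiam (hfar k (by omega))
  have h3 : turn u k + turn u (k + 1) - turn u 1 ≤ 6 * Real.pi + 7 / 20 := by
    have := O.monotone_turn (Nat.zero_le 1)
    rw [turn_zero] at this
    rw [turn_succ]
    linarith
  have h4 := mul_le_mul_of_nonneg_left h3 hd0.le
  have g0 := abs_le.1 (O.abs_dot_le hd 0)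
  have g1 := abs_le.1 (O.abs_dot_le hd 1)
  have gk := abs_le.1 (O.abs_dot_le hd k)
  have gk' := abs_le.1 (O.abs_dot_le hd (k + 1))
  obtain ⟨c1, c2, c3, c4⟩ := (O k).bounds_start hd
  obtain ⟨e1, e2, e3, e4⟩ := (O 0).bounds_start hd
  have h5 := abs_le.1 h1
  have h6 : 3 * d ≤ Real.pi * d := by
    have := Real.pi_gt_three
    gcongr
  refine abs_le.2 ⟨?_, ?_⟩ <;> linarith

lemma IsOrbit.far (O : IsOrbit K X p u a b ρ) (hd0 : 0 < d) (hd : ∀ z ∈ K, ‖z‖ ≤ d)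
    (hdiam : ∀ z ∈ K, ∀ z' ∈ K, ‖z - z'‖ ≤ d) (hX : (4 * Real.pi + 11) * d ≤ ‖X 0‖) {k : ℕ}
    (hk : turn u k ≤ 3 * Real.pi) : 8 * d ≤ ‖X k‖ := by
  have := abs_le.1 (O.annulus hd0 hd hdiam hX k hk)
  linarith

/-- Each step reverses the direction and turns it clockwise; far from `K` the turn is acute, so the
arcsine is the true angle. -/
lemma IsOrbit.direction_eq (O : IsOrbit K X p u a b ρ) (hd0 : 0 < d) (hd : ∀ z ∈ K, ‖z‖ ≤ d)
    (hdiam : ∀ z ∈ K, ∀ z' ∈ K, ‖z - z'‖ ≤ d) (k : ℕ) (h : ∀ j < k, 8 * d ≤ ‖X j‖) :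
    u k = (-1) ^ k * exp (-(turn u k : ℝ) * I) * u 0 := by
  induction k with
  | zero => simp
  | succ k ih =>
    have h1 := ih fun j hj => h j (by omega)
    have h2 := h k (by omega)
    have hdot := (O k).dot_uv_neg hdiam (by linarith [((O k).bounds_start hd).2.2.1])
    rw [eq_neg_exp_mul (O k).norm_u (O k).norm_v hdot.le, turn_succ]
    nth_rw 2 [h1]
    rw [ofReal_add, neg_add, add_mul, exp_add]
    ring

lemma cross_exp_mul {v : ℂ} (hv : ‖v‖ = 1) (t : ℝ) : cross v (exp (-t * I) * v) = -Real.sin t := by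
  have h := sq_add_sq_of_norm_eq_one hv
  rw [← ofReal_neg, exp_mul_I, ← ofReal_cos, ← ofReal_sin, Real.cos_neg, Real.sin_neg]
  simp [cross, -ofReal_sin, -ofReal_cos]
  linear_combination (-Real.sin t) * h

lemma IsOrbit.abs_cross_sub_le (O : IsOrbit K X p u a b ρ) (hd0 : 0 < d)
    (hd : ∀ z ∈ K, ‖z‖ ≤ d) (hdiam : ∀ z ∈ K, ∀ z' ∈ K, ‖z - z'‖ ≤ d)
    (hX : (4 * Real.pi + 11) * d ≤ ‖X 0‖) {i : ℕ} (hi : turn u (2 * i) ≤ 3 * Real.pi) :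
    |cross (X 0) (X (2 * i)) + a 0 * a (2 * i) * Real.sin (turn u (2 * i))| ≤
      15 / 49 * (a 0 * a (2 * i)) := by
  have h1 := O.direction_eq hd0 hd hdiam (2 * i)
    fun j hj => O.far hd0 hd hdiam hX ((O.monotone_turn hj.le).trans hi)
  rw [pow_mul, neg_one_sq, one_pow, one_mul] at h1
  have h2 : cross (u 0) (u (2 * i)) = -Real.sin (turn u (2 * i)) := by
    rw [h1]; exact cross_exp_mul (O 0).norm_u _
  have f0 := O.far hd0 hd hdiam hX (k := 0) (by rw [turn_zero]; positivity)
  have fi := O.far hd0 hd hdiam hX hi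
  have h3 := OuterLength.abs_cross_sub_le hd0 (hd _ (O 0).l_mem) (hd _ (O (2 * i)).l_mem)
    (O 0).norm_u (O (2 * i)).norm_u (a := a 0) (a' := a (2 * i))
    (by linarith [((O 0).bounds_start hd).1]) (by linarith [((O (2 * i)).bounds_start hd).1])
  rwa [← (O 0).x_eq, ← (O (2 * i)).x_eq, h2, mul_neg, sub_neg_eq_add] at h3

/-- The first even time at which the turning reaches `c` overshoots by at most two angles of size `9
/ 40`. -/
lemma IsOrbit.exists_turn_mem_Icc (O : IsOrbit K X p u a b ρ) (hd0 : 0 < d)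
    (hd : ∀ z ∈ K, ‖z‖ ≤ d) (hdiam : ∀ z ∈ K, ∀ z' ∈ K, ‖z - z'‖ ≤ d)
    (hX : (4 * Real.pi + 11) * d ≤ ‖X 0‖) {c : ℝ} (hc : 0 < c) (hc' : c ≤ 5 * Real.pi / 2) {k : ℕ}
    (hk : c ≤ turn u k) : ∃ i, c ≤ turn u (2 * i) ∧ turn u (2 * i) ≤ c + 9 / 20 := by
  classical
  have hex : ∃ i, c ≤ turn u (2 * i) := ⟨k, hk.trans (O.monotone_turn (by omega))⟩
  refine ⟨Nat.find hex, Nat.find_spec hex, ?_⟩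
  have hspec := Nat.find_spec hex
  have hmin := fun m hm => Nat.find_min (H := hex) (m := m) hm
  generalize Nat.find hex = i at *
  cases i with
  | zero => rw [mul_zero, turn_zero] at hspec; linarith
  | succ i =>
    have h1 := not_le.1 (hmin i (by omega))
    have hπ := Real.pi_gt_three
    have h2 := O.arcsin_le hd0 hd hdiam (O.far hd0 hd hdiam hX (k := 2 * i) (by linarith))
    have h3 := turn_succ u (2 * i)
    have h4 := O.arcsin_le hd0 hd hdiam (O.far hd0 hd hdiam hX (k := 2 * i + 1) (by linarith))
    have h5 := turn_succ u (2 * i + 1)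
    rw [show 2 * (i + 1) = 2 * i + 1 + 1 by ring]
    linarith

end Orbit

/-! ### Wrapping around, and the conclusion. -/

lemma turn_le_of_mem_onceAroundOrbit {K : Set ℂ} {x : ℂ} {p u : ℕ → ℂ} {a b ρ : ℕ → ℝ} {d : ℝ}
    (O : IsOrbit K (fun k => (billiardMap K)^[k] x) p u a b ρ) (hd0 : 0 < d)
    (hd : ∀ z ∈ K, ‖z‖ ≤ d) (hdiam : ∀ z ∈ K, ∀ z' ∈ K, ‖z - z'‖ ≤ d)
    (hX : (4 * Real.pi + 11) * d ≤ ‖x‖) {k : ℕ}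
    (hk : ∀ N, IsLeast {N | WrapsAt K x N} N → k ≤ 2 * N) : turn u k ≤ 3 * Real.pi := by
  classical
  by_contra! hlt
  have hπ := Real.pi_gt_three
  -- Near the turnings `3π/2` and `5π/2` the sine is close to `-1` and `1`, which dominates the
  -- relative error `15 / 49` in `IsOrbit.abs_cross_sub_le` and fixes the sign of the argument.
  obtain ⟨i, hi, hi'⟩ := O.exists_turn_mem_Icc hd0 hd hdiam hX (c := 3 * Real.pi / 2)
    (by positivity) (by linarith) (k := k) (by linarith)
  obtain ⟨j, hj, hj'⟩ := O.exists_turn_mem_Icc hd0 hd hdiam hX (c := 5 * Real.pi / 2)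
    (by positivity) le_rfl (k := k) (by linarith)
  have hij : i < j := by
    by_contra! h
    have := O.monotone_turn (Nat.mul_le_mul_left 2 h)
    linarith
  have hcos : ∀ t : ℝ, 0 ≤ t → t ≤ 9 / 20 → 1 / 2 ≤ Real.cos t := fun t h1 h2 => by
    have := Real.one_sub_sq_div_two_le_cos (x := t)
    nlinarith
  have hpos : 0 < polarArg x ((billiardMap K)^[2 * i] x) := by
    apply polarArg_pos
    have h1 := abs_le.1 (O.abs_cross_sub_le hd0 hd hdiam hX (i := i) (by linarith))
    have h2 := hcos (turn u (2 * i) - 3 * Real.pi / 2) (by linarith) (by linarith)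
    have h3 : Real.sin (turn u (2 * i)) = -Real.cos (turn u (2 * i) - 3 * Real.pi / 2) := by
      rw [← Real.sin_sub_pi_div_two, ← Real.sin_sub_two_pi]
      congr 1; ring
    have h4 := mul_pos (O 0).a_pos (O (2 * i)).a_pos
    rw [h3] at h1
    have h5 := mul_le_mul_of_nonneg_left h2 h4.le
    simp only [Function.iterate_zero, id] at h1
    linarith [h1.1]
  have hneg : polarArg x ((billiardMap K)^[2 * j] x) < 0 := by
    apply polarArg_neg
    have h1 := abs_le.1 (O.abs_cross_sub_le hd0 hd hdiam hX (i := j) (by linarith))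
    have h2 := hcos (turn u (2 * j) - 5 * Real.pi / 2) (by linarith) (by linarith)
    have h3 : Real.sin (turn u (2 * j)) = Real.cos (turn u (2 * j) - 5 * Real.pi / 2) := by
      rw [← Real.sin_add_pi_div_two, ← Real.sin_sub_two_pi (turn u (2 * j))]
      congr 1; ring
    have h4 := mul_pos (O 0).a_pos (O (2 * j)).a_pos
    rw [h3] at h1
    have h5 := mul_le_mul_of_nonneg_left h2 h4.le
    simp only [Function.iterate_zero, id] at h1
    linarith [h1.2]
  -- A discrete intermediate value argument: the argument is positive at index `i` and negative at
  -- `j`, so it first becomes non-positive at some wrapping index in between.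
  have hwrap : ∃ m, m ≤ j ∧ WrapsAt K x m := by
    by_contra! hno
    have hall : ∀ m, i ≤ m → m ≤ j → 0 < polarArg x ((billiardMap K)^[2 * m] x) := by
      intro m hm
      induction m, hm using Nat.le_induction with
      | base => exact fun _ => hpos
      | succ m hm ih =>
        intro hmj
        by_contra! hc
        exact hno (m + 1) hmj ⟨Nat.succ_pos m, ih (by omega), hc⟩
    exact (hall j hij.le le_rfl).not_gt hneg
  obtain ⟨m, hmj, hm⟩ := hwrap
  have hex : ∃ m, WrapsAt K x m := ⟨m, hm⟩
  have h1 := hk (Nat.find hex) ⟨Nat.find_spec hex, fun n hn => Nat.find_min' hex hn⟩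
  have h2 := Nat.find_min' hex hm
  -- The first wrapping time is at most `j`, so `k ≤ 2 * j`, where the turning is at most `5π/2 +
  -- 9/20 < 3π`.
  have h3 := O.monotone_turn (show k ≤ 2 * j by omega)
  linarith

end OuterLength

theorem theorem3p2 (n : ℕ) (Q : Set ℂ) (hQ : OuterLength.IsConvexNGon n Q) (h0 : (0 : ℂ) ∈ Q) :
    ∃ C₁ C₂ : ℝ,
      C₁ ≤ (4 * Real.pi + 3) * Metric.diam Q ∧ C₂ = (4 * Real.pi + 11) * Metric.diam Q ∧
      ∀ x ∈ OuterLength.domain Q, C₂ ≤ ‖x‖ →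
        ∀ z ∈ OuterLength.onceAroundOrbit Q x, |‖z‖ - ‖x‖| ≤ C₁ := by
  obtain ⟨hn, V, hV, -, hQV⟩ := hQ
  have hbdd : Bornology.IsBounded Q := by
    rw [hQV]
    exact isBounded_convexHull.2 V.finite_toSet.isBounded
  have hnt : Q.Nontrivial := by
    obtain ⟨v, hv, w, hw, hvw⟩ := Finset.one_lt_card.1 (show 1 < V.card by omega)
    rw [hQV]
    exact ⟨v, subset_convexHull ℝ _ hv, w, subset_convexHull ℝ _ hw, hvw⟩
  have hdiam : ∀ z ∈ Q, ∀ z' ∈ Q, ‖z - z'‖ ≤ Metric.diam Q := fun z hz z' hz' => by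
    rw [← dist_eq_norm]
    exact Metric.dist_le_diam_of_mem hbdd hz hz'
  have hd : ∀ z ∈ Q, ‖z‖ ≤ Metric.diam Q := fun z hz => by simpa using hdiam z hz 0 h0
  have hd0 : 0 < Metric.diam Q := by
    obtain ⟨z, hz, z', hz', hne⟩ := hnt
    exact (norm_pos_iff.2 (sub_ne_zero.2 hne)).trans_le (hdiam z hz z' hz')
  refine ⟨_, _, le_rfl, rfl, fun x hx hX z hz => ?_⟩
  obtain ⟨p, u, a, b, ρ, O⟩ := OuterLength.exists_isOrbit hnt hx
  obtain ⟨k, rfl, hk⟩ := hz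
  exact O.annulus hd0 hd hdiam hX k
    (OuterLength.turn_le_of_mem_onceAroundOrbit O hd0 hd hdiam hX hk)
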